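/- Let $M$ be a Markov decision process with finite state set $V$, partitioned into controlled and probabilistic states, with an edge relation $E\subseteq V\times V$ without sinks and, for each probabilistic state, a probability distribution over its outgoing edges. Let $\mathsf{cost}:E\to\mathbb Z$ and $\mathsf{parity}:V\to\mathbb N$ be arbitrary functions. A strategy $\sigma$ assigns to every finite word of states that ends in a controlled state $s$ a probability distribution over the outgoing edges of $s$; together with an initial state $q$ it induces a probability measure $\mathbb P^\sigma_q$ on runs (infinite paths) $s_0s_1s_2\ldots$ with $s_0=q$. For $k\in\mathbb N$ let $\mathrm{EN}(k)$ be the set of runs with $k+\sum_{i=0}^{l}\mathsf{cost}(s_i,s_{i+1})\ge 0$ for all $l\ge 0$; let $\mathrm{Parity}$ be the set of runs on which the minimal priority $\mathsf{parity}(s_i)$ that appears infinitely often is even; let $\mathrm{PosMP}$ be the set of runs with $\liminf_{n\to\infty}\frac1n\sum_{i=0}^{n-1}\mathsf{cost}(s_i,s_{i+1})>0$; and for $T\subseteq V$ let $\Diamond T$ be the set of runs that visit $T$. Put $$A=\{q\in V\mid \exists k\in\mathbb N\ \exists\sigma:\ \mathbb P^\sigma_q(\mathrm{EN}(k)\cap\mathrm{Parity})=1\},\qquad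 B=\{q\in V\mid \exists\sigma:\ \mathbb P^\sigma_q(\mathrm{PosMP}\cap\mathrm{Parity})=1\}.$$ Then for every state $p\in V$, $$\sup_{k\in\mathbb N}\ \sup_\sigma\ \mathbb P^\sigma_p(\mathrm{EN}(k)\cap\mathrm{Parity})\;=\;\sup_\sigma\ \mathbb P^\sigma_p(\Diamond(A\cup B)).$$ -/

import Mathlib

open MeasureTheory ProbabilityTheory Filter Finset

/-- A Markov decision process with state set `V`. The states are partitioned into the controlled
states `controlled` and the probabilistic states (the complement), `Edge` is the edge relation of a
directed graph without sinks, and `prob` assigns to every probabilistic state a probability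
distribution over its outgoing edges, given as a distribution over the successor states. -/
structure MDP (V : Type*) where
  controlled : Set V
  Edge : V → V → Prop
  sinkless : ∀ s, ∃ t, Edge s t
  prob : (s : V) → s ∉ controlled → PMF V
  edge_of_prob : ∀ s (hs : s ∉ controlled) t, prob s hs t ≠ 0 → Edge s t

namespace MDP

/-- A (history-dependent, randomised) strategy: it assigns to each word `w s`, with `w` a finite
word over the states and `s` a controlled state, a distribution over the outgoing edges of `s`. -/
structure Strategy {V : Type*} (M : MDP V) where
  move : List V → (s : V) → s ∈ M.controlled → PMF V
  edge_of_move : ∀ w s (hs : s ∈ M.controlled) t, move w s hs t ≠ 0 → M.Edge s t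

/-- The distribution of the next state after the finite path `w s`
in the Markov chain induced by `σ`. -/
noncomputable def next {V : Type*} (M : MDP V) (σ : M.Strategy) (w : List V) (s : V) : PMF V :=
  open Classical in
  if hs : s ∈ M.controlled then σ.move w s hs else M.prob s hs

/-- The transition kernel from the history `x 0, …, x n` to the state at time `n + 1`,
in the Markov chain induced by `σ`. -/
noncomputable def stepKernel {V : Type*} [Finite V] [MeasurableSpace V] [DiscreteMeasurableSpace V]
    (M : MDP V) (σ : M.Strategy) (n : ℕ) : Kernel (Iic n → V) V :=
  Kernel.ofFunOfCountable fun x =>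
    (M.next σ (List.ofFn fun i : Fin n => x ⟨i, mem_Iic.2 i.isLt.le⟩)
      (x ⟨n, mem_Iic.2 le_rfl⟩)).toMeasure

instance {V : Type*} [Finite V] [MeasurableSpace V] [DiscreteMeasurableSpace V]
    (M : MDP V) (σ : M.Strategy) (n : ℕ) : IsMarkovKernel (M.stepKernel σ n) :=
  ⟨fun x => by unfold stepKernel; exact PMF.toMeasure.isProbabilityMeasure _⟩

/-- The probability measure on infinite sequences of states (with the product σ-algebra, generated
by the cylinders) that the strategy `σ` induces when starting in the state `p`. -/
noncomputable def runMeasure {V : Type*} [Finite V] [MeasurableSpace V] [DiscreteMeasurableSpace V]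
    (M : MDP V) (σ : M.Strategy) (p : V) : Measure (ℕ → V) :=
  Kernel.traj (X := fun _ => V) (M.stepKernel σ) 0 (fun _ => p)

/-- The value of the objective `O` at `p`: the supremum over all strategies of the probability
of `O`, when starting in `p`. -/
noncomputable def value {V : Type*} [Finite V] [MeasurableSpace V] [DiscreteMeasurableSpace V]
    (M : MDP V) (p : V) (O : Set (ℕ → V)) : ENNReal :=
  ⨆ σ : M.Strategy, M.runMeasure σ p O

/-- The runs: infinite paths of the graph. -/
def runs {V : Type*} (M : MDP V) : Set (ℕ → V) :=
  {ρ | ∀ n, M.Edge (ρ n) (ρ (n + 1))}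

/-- The reachability objective: the runs that visit `T`. -/
def reach {V : Type*} (M : MDP V) (T : Set V) : Set (ℕ → V) :=
  {ρ ∈ M.runs | ∃ n, ρ n ∈ T}

/-- The parity objective: the runs on which the minimal priority
that appears infinitely often is even. -/
def parityObj {V : Type*} (M : MDP V) (parity : V → ℕ) : Set (ℕ → V) :=
  {ρ ∈ M.runs | ∃ c, IsLeast {c : ℕ | ∃ᶠ n in atTop, parity (ρ n) = c} c ∧ Even c}

/-- The sum of the costs of the first `n` edges of `ρ`. Here and below the cost function is given
on all pairs of states; only its values on edges matter, as objectives consist of runs. -/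
def totalCost {V : Type*} (cost : V → V → ℤ) (ρ : ℕ → V) (n : ℕ) : ℤ :=
  ∑ i ∈ range n, cost (ρ i) (ρ (i + 1))

/-- The `k`-energy objective: the runs on which the energy level,
which starts with `k`, never drops below zero. -/
def energy {V : Type*} (M : MDP V) (cost : V → V → ℤ) (k : ℕ) : Set (ℕ → V) :=
  {ρ ∈ M.runs | ∀ n, 0 ≤ (k : ℤ) + totalCost cost ρ n}

/-- The positive mean-payoff objective: the runs on which the limit inferior
of the average cost of the first `n` edges is positive. -/
def posMP {V : Type*} (M : MDP V) (cost : V → V → ℤ) : Set (ℕ → V) :=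
  {ρ ∈ M.runs |
    0 < liminf (fun n : ℕ => (((1 / (n : ℝ)) * (totalCost cost ρ n : ℝ) : ℝ) : EReal)) atTop}

/-- The limit value of `p`: the supremum over all initial energy levels `k`
of the value of the `k`-energy-parity objective. -/
noncomputable def limitValue {V : Type*} [Finite V] [MeasurableSpace V] [DiscreteMeasurableSpace V]
    (M : MDP V) (cost : V → V → ℤ) (parity : V → ℕ) (p : V) : ENNReal :=
  ⨆ k : ℕ, M.value p (M.energy cost k ∩ M.parityObj parity)

/-- The states from which, for some `k`, some strategy satisfies
the `k`-energy-parity objective almost surely. -/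
def setA {V : Type*} [Finite V] [MeasurableSpace V] [DiscreteMeasurableSpace V]
    (M : MDP V) (cost : V → V → ℤ) (parity : V → ℕ) : Set V :=
  {q | ∃ k : ℕ, ∃ σ : M.Strategy,
    M.runMeasure σ q (M.energy cost k ∩ M.parityObj parity) = 1}

/-- The states from which some strategy satisfies
the positive mean-payoff-parity objective almost surely. -/
def setB {V : Type*} [Finite V] [MeasurableSpace V] [DiscreteMeasurableSpace V]
    (M : MDP V) (cost : V → V → ℤ) (parity : V → ℕ) : Set V :=
  {q | ∃ σ : M.Strategy, M.runMeasure σ q (M.posMP cost ∩ M.parityObj parity) = 1}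

end MDP

/-!
# The limit value of energy-parity objectives in finite Markov decision processes

Write `L p` for the limit value at `p`.

*Reaching `A ∪ B` is a lower bound for `L`.* On `A ∪ B` the limit value is `1`: a run of positive
mean payoff has bounded total losses, so it satisfies `EN(k)` for some `k`, and continuity of the
measure from below applies. Moreover `L p` is at least the mean of `L` over the successors of `p`,
for each first move (`sum_mul_limitValue_le`), because near-optimal strategies for the successors
can be glued to the first move, at the price of a finite amount of initial energy. By induction on
the horizon, no strategy visits `A ∪ B` within `n` steps with probability more than `L p`.

*It is an upper bound.* For every strategy, almost every run in `EN(k) ∩ Parity` visits `A ∪ B`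
(`ae_mem_reach`). Almost surely the set `U` of the edges that a run takes infinitely often is an end
component (`ae_isEndComponent_recurrentEdge`), and there are finitely many candidates for `U`. The
minimal priority on `U` is even, so a run that visits exactly the states of `U` infinitely often
satisfies the parity objective. For the Bellman operator `T` of the total cost on `U` there is
(`bellman_dichotomy`)
* a potential `h` with `h + η ≤ T h` for some `η > 0`. Then the stationary strategy that nearly
  maximises `cost + h`, and gives each edge of `U` positive probability, has positive mean payoff by
  an exponential supermartingale (`ae_linear_growth`), and it visits exactly the states of `U`
  infinitely often. So these states belong to `B`; or
* a potential `h` with `T h ≤ h`. Then the total cost plus `h` is eventually a supermartingale with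
  bounded increments, so it converges on `EN(k)`. As its increments have finitely many values, they
  vanish eventually, and each edge `(s, t)` of `U` satisfies `h s = cost s t + h t`. Hence the total
  cost is bounded along all paths in `U`, and a stationary strategy shows that the states of `U`
  belong to `A`.

The dichotomy comes from the optimal stopping values `u (n + 1) = max 0 (T (u n))`. Their
oscillation on a strongly connected `U` is bounded uniformly in `n`. If they are bounded, then their
supremum satisfies `T h ≤ h`; otherwise `u m > 2` on `U` for some `m`, and the maximum of
`u i - i / m` over `i ≤ m` is increased by at least `1 / m`.
-/

/-! ### The run measure -/

namespace MDP

/-- The word formed by the first `n` states of the sequence `ρ`. -/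
def history {V : Type*} (ρ : ℕ → V) (n : ℕ) : List V := List.ofFn fun i : Fin n => ρ i

/-- The sequences that agree with `x` up to time `n`. -/
def cylinderSet {V : Type*} (x : ℕ → V) (n : ℕ) : Set (ℕ → V) := {ρ | ∀ i ≤ n, ρ i = x i}

lemma cylinderSet_eq_preimage {V : Type*} (x : ℕ → V) (n : ℕ) :
    cylinderSet x n = Preorder.frestrictLe (π := fun _ : ℕ => V) n ⁻¹'
      {Preorder.frestrictLe (π := fun _ : ℕ => V) n x} := by
  ext ρ
  simp [cylinderSet, funext_iff, Preorder.frestrictLe]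

lemma history_eq_of_mem_cylinderSet {V : Type*} {x ρ : ℕ → V} {n : ℕ} (h : ρ ∈ cylinderSet x n) :
    history ρ n = history x n := by
  unfold history
  congr 1
  ext i
  exact h i i.isLt.le

lemma edge_of_next {V : Type*} {M : MDP V} {σ : M.Strategy} {w : List V} {s t : V}
    (h : M.next σ w s t ≠ 0) : M.Edge s t := by
  unfold next at h
  split_ifs at h with hs
  · exact σ.edge_of_move w s hs t h
  · exact M.edge_of_prob s hs t h

/-- What remains of the strategy `σ` once the run has left its initial state `p`. -/
def Strategy.tail {V : Type*} {M : MDP V} (σ : M.Strategy) (p : V) : M.Strategy where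
  move w s hs := σ.move (p :: w) s hs
  edge_of_move w s hs t h := σ.edge_of_move (p :: w) s hs t h

lemma next_tail {V : Type*} {M : MDP V} (σ : M.Strategy) (p : V) (w : List V) (s : V) :
    M.next (σ.tail p) w s = M.next σ (p :: w) s := rfl

/-- The sequence `p, ρ 0, ρ 1, …`. -/
def prepend {V : Type*} (p : V) (ρ : ℕ → V) : ℕ → V
  | 0 => p
  | n + 1 => ρ n

lemma history_succ {V : Type*} (ρ : ℕ → V) (n : ℕ) :
    history ρ (n + 1) = ρ 0 :: history (fun i => ρ (i + 1)) n := by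
  unfold history
  rw [List.ofFn_succ]
  rfl

lemma measurable_prepend {V : Type*} [MeasurableSpace V] (p : V) :
    Measurable (prepend p) := by
  rw [measurable_pi_iff]
  rintro (_ | n)
  · exact measurable_const
  · exact measurable_pi_apply n

lemma prepend_preimage_cylinderSet {V : Type*} {p : V} (x : ℕ → V) (n : ℕ)
    [Decidable (x 0 = p)] :
    prepend p ⁻¹' cylinderSet x (n + 1) =
      if x 0 = p then cylinderSet (fun i => x (i + 1)) n else ∅ := by
  ext ρ
  split_ifs with h
  · constructor
    · intro hρ i hi
      exact hρ (i + 1) (by omega)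
    · rintro hρ (_ | i) hi
      · exact h.symm
      · exact hρ i (by omega)
  · simp only [Set.mem_preimage, Set.mem_empty_iff_false, iff_false]
    exact fun hρ => h (hρ 0 (Nat.zero_le _)).symm

section RunMeasure

variable {V : Type*} [Fintype V] [MeasurableSpace V] [DiscreteMeasurableSpace V]
  {M : MDP V} {σ : M.Strategy} {p : V}

instance : IsProbabilityMeasure (M.runMeasure σ p) := by
  unfold runMeasure; infer_instance

lemma measurable_pair (G : V → V → ℝ) (n : ℕ) :
    Measurable fun ρ : ℕ → V => G (ρ n) (ρ (n + 1)) :=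
  (Measurable.of_discrete (f := fun x : V × V => G x.1 x.2)).comp
    (g := fun x : V × V => G x.1 x.2) (f := fun ρ : ℕ → V => (ρ n, ρ (n + 1)))
    ((measurable_pi_apply n).prodMk (measurable_pi_apply (n + 1)))

lemma integrable_pair (μ : Measure (ℕ → V)) [IsFiniteMeasure μ] (G : V → V → ℝ) (n : ℕ) :
    Integrable (fun ρ : ℕ → V => G (ρ n) (ρ (n + 1))) μ := by
  obtain ⟨C, hC⟩ := (Set.finite_range fun x : V × V => ‖G x.1 x.2‖).bddAbove
  exact Integrable.of_bound (measurable_pair G n).aestronglyMeasurable C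
    (.of_forall fun ρ => hC ⟨(ρ n, ρ (n + 1)), rfl⟩)

/-- **One-step formula**: given the history up to time `n`, the next state is distributed according
to `MDP.next`. -/
lemma condExp_step (G : V → V → ℝ) (n : ℕ) :
    (M.runMeasure σ p)[fun ρ => G (ρ n) (ρ (n + 1)) | Filtration.piLE n]
      =ᵐ[M.runMeasure σ p]
      fun ρ => ∑ t, (M.next σ (history ρ n) (ρ n) t).toReal * G (ρ n) t := by
  classical
  have hm : Measurable fun ρ : ℕ → V => G (ρ n) (ρ (n + 1)) :=
    measurable_pair G n
  have hi := integrable_pair (M.runMeasure σ p) G n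
  have h := Kernel.condExp_traj (X := fun _ => V) (κ := M.stepKernel σ) (Nat.zero_le n)
    (x₀ := fun _ => p) hi
  refine h.trans (.of_forall fun ρ => ?_)
  dsimp only
  rw [Kernel.integral_traj _ hm.aestronglyMeasurable]
  have h1 : ∀ y : ℕ → V, G (Function.updateFinset y (Iic n) (Preorder.frestrictLe n ρ) n)
      (Function.updateFinset y (Iic n) (Preorder.frestrictLe n ρ) (n + 1))
      = G (ρ n) (y (n + 1)) := by
    intro y
    simp [Function.updateFinset, Preorder.frestrictLe]
  simp only [h1]
  have h2 := Kernel.map_traj_succ_self (X := fun _ => V) (κ := M.stepKernel σ) (a := n)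
  have h3 : (Kernel.traj (X := fun _ => V) (M.stepKernel σ) n (Preorder.frestrictLe n ρ)).map
      (fun x => x (n + 1)) = (M.next σ (history ρ n) (ρ n)).toMeasure := by
    rw [← Kernel.map_apply _ (measurable_pi_apply (n + 1)), h2]
    rfl
  rw [← integral_map (φ := fun y : ℕ → V => y (n + 1)) (f := fun t => G (ρ n) t)
    (measurable_pi_apply (n + 1)).aemeasurable
    Measurable.of_discrete.aestronglyMeasurable, h3, PMF.integral_eq_sum]
  simp

lemma ae_zero_eq : ∀ᵐ ρ ∂M.runMeasure σ p, ρ 0 = p := by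
  have h := Kernel.traj_map_frestrictLe_apply (X := fun _ => V) (κ := M.stepKernel σ) 0 0
    (fun _ => p)
  rw [Kernel.partialTraj_self] at h
  have h2 : ∀ᵐ y ∂(M.runMeasure σ p).map (Preorder.frestrictLe 0),
      y = fun _ => p := by
    unfold runMeasure
    rw [h, Kernel.id_apply, ae_dirac_eq]
    exact rfl
  filter_upwards [ae_of_ae_map (by fun_prop) h2] with ρ hρ
  exact congrFun hρ ⟨0, by simp⟩

lemma measurableSet_cylinderSet_piLE (x : ℕ → V) (n : ℕ) :
    MeasurableSet[Filtration.piLE (X := fun _ : ℕ => V) n] (cylinderSet x n) := by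
  rw [Filtration.piLE_eq_comap_frestrictLe, cylinderSet_eq_preimage]
  exact ⟨_, MeasurableSet.singleton _, rfl⟩

lemma measurableSet_cylinderSet (x : ℕ → V) (n : ℕ) : MeasurableSet (cylinderSet x n) :=
  (Filtration.piLE (X := fun _ : ℕ => V)).le n _ (measurableSet_cylinderSet_piLE x n)

lemma runMeasure_cylinderSet_zero (x : ℕ → V) [Decidable (x 0 = p)] :
    M.runMeasure σ p (cylinderSet x 0) = if x 0 = p then 1 else 0 := by
  split_ifs with h
  · rw [← measure_univ (μ := M.runMeasure σ p)]
    refine measure_congr ?_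
    rw [eventuallyEq_univ]
    filter_upwards [ae_zero_eq] with ρ hρ i hi
    obtain rfl : i = 0 := by omega
    rw [hρ, h]
  · rw [measure_eq_zero_iff_ae_notMem]
    filter_upwards [ae_zero_eq] with ρ hρ hmem
    exact h (by rw [← hρ, hmem 0 le_rfl])

lemma runMeasure_cylinderSet_succ (x : ℕ → V) (n : ℕ) :
    M.runMeasure σ p (cylinderSet x (n + 1)) =
      M.runMeasure σ p (cylinderSet x n) * M.next σ (history x n) (x n) (x (n + 1)) := by
  classical
  let G : V → V → ℝ := fun _ t => if t = x (n + 1) then 1 else 0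
  have hms := measurableSet_cylinderSet x n
  have h1 := setIntegral_condExp ((Filtration.piLE (X := fun _ : ℕ => V)).le n)
    (integrable_pair (M.runMeasure σ p) G n) (measurableSet_cylinderSet_piLE x n)
  have h2 : ∫ ρ in cylinderSet x n, G (ρ n) (ρ (n + 1)) ∂M.runMeasure σ p
      = (M.runMeasure σ p).real (cylinderSet x (n + 1)) := by
    have hsplit : cylinderSet x (n + 1) = cylinderSet x n ∩ {ρ | ρ (n + 1) = x (n + 1)} := by
      ext ρ
      simp only [cylinderSet, Set.mem_ofPred_eq, Set.mem_inter_iff, Nat.le_succ_iff]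
      grind
    have hm1 : MeasurableSet {ρ : ℕ → V | ρ (n + 1) = x (n + 1)} :=
      measurable_pi_apply (n + 1) (MeasurableSet.singleton _)
    have hG : (fun ρ : ℕ → V => G (ρ n) (ρ (n + 1))) =
        {ρ : ℕ → V | ρ (n + 1) = x (n + 1)}.indicator 1 := by
      ext ρ
      simp [G, Set.indicator_apply]
    rw [hG, setIntegral_indicator hm1, ← hsplit]
    simp
  have h3 : ∫ ρ in cylinderSet x n, (M.runMeasure σ p)[fun ρ : ℕ → V => G (ρ n) (ρ (n + 1)) |
      Filtration.piLE (X := fun _ : ℕ => V) n] ρ ∂M.runMeasure σ p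
      = (M.runMeasure σ p).real (cylinderSet x n) *
        (M.next σ (history x n) (x n) (x (n + 1))).toReal := by
    rw [setIntegral_congr_ae (g := fun _ => (M.next σ (history x n) (x n) (x (n + 1))).toReal) hms]
    · simp
    · filter_upwards [condExp_step (M := M) (σ := σ) (p := p) G n] with ρ hρ hmem
      rw [hρ, history_eq_of_mem_cylinderSet hmem, hmem n le_rfl]
      simp [G]
  rw [h2, h3, measureReal_def, measureReal_def, ← ENNReal.toReal_mul] at h1
  refine ((ENNReal.toReal_eq_toReal_iff' ?_ ?_).1 h1).symm
  · exact ENNReal.mul_ne_top (measure_ne_top _ _) (PMF.apply_ne_top _ _)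
  · exact measure_ne_top _ _

/-- Finite measures on sequences are determined by their values on the cylinders. -/
lemma ext_of_cylinderSet {μ ν : Measure (ℕ → V)} [IsFiniteMeasure μ] [IsFiniteMeasure ν]
    (h : ∀ x n, μ (cylinderSet x n) = ν (cylinderSet x n)) : μ = ν := by
  have h1 : ∀ n, μ.map (Preorder.frestrictLe n) = ν.map (Preorder.frestrictLe n) := by
    intro n
    refine Measure.ext_of_singleton fun y => ?_
    have hm := Preorder.measurable_frestrictLe (X := fun _ : ℕ => V) n
    rw [Measure.map_apply hm (MeasurableSet.singleton _),
      Measure.map_apply hm (MeasurableSet.singleton _)]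
    have hy : y = Preorder.frestrictLe n
        (fun i : ℕ => y ⟨min i n, mem_Iic.2 (min_le_right i n)⟩) := by
      ext i
      simp only [Preorder.frestrictLe_apply]
      congr 1
      ext
      simp [mem_Iic.1 i.2]
    rw [hy, ← cylinderSet_eq_preimage, h]
  refine IsProjectiveLimit.unique (P := fun I : Finset ℕ => μ.map I.restrict) (fun I => rfl)
    fun I => ?_
  have hI := I.subset_Iic_sup_id
  change ν.map I.restrict = μ.map I.restrict
  rw [← restrict₂_comp_restrict hI, ← Measure.map_map (by fun_prop) (by fun_prop),
    ← Measure.map_map (by fun_prop) (by fun_prop)]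
  exact congrArg _ (h1 _).symm

lemma ae_next_ne_zero :
    ∀ᵐ ρ ∂M.runMeasure σ p, ∀ n, M.next σ (history ρ n) (ρ n) (ρ (n + 1)) ≠ 0 := by
  rw [ae_all_iff]
  intro n
  rw [ae_iff]
  refine measure_mono_null (t := ⋃ y : Iic (n + 1) → V, {ρ : ℕ → V |
    (fun i : Iic (n + 1) => ρ i) = y ∧ M.next σ (history ρ n) (ρ n) (ρ (n + 1)) = 0}) ?_ ?_
  · intro ρ hρ
    simp only [ne_eq, not_not, Set.mem_ofPred_eq] at hρ
    simp [hρ]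
  · rw [measure_iUnion_null_iff]
    intro y
    rcases Set.eq_empty_or_nonempty {ρ : ℕ → V |
      (fun i : Iic (n + 1) => ρ i) = y ∧ M.next σ (history ρ n) (ρ n) (ρ (n + 1)) = 0} with h | h
    · rw [h, measure_empty]
    · obtain ⟨x, hx, hx0⟩ := h
      refine measure_mono_null (t := cylinderSet x (n + 1)) ?_ ?_
      · rintro ρ ⟨hρ, -⟩ i hi
        exact congrFun (hρ.trans hx.symm) ⟨i, mem_Iic.2 hi⟩
      · rw [runMeasure_cylinderSet_succ, hx0, mul_zero]

lemma runMeasure_cylinderSet (x : ℕ → V) (n : ℕ) [Decidable (x 0 = p)] :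
    M.runMeasure σ p (cylinderSet x n) =
      (if x 0 = p then 1 else 0) * ∏ i ∈ range n, M.next σ (history x i) (x i) (x (i + 1)) := by
  induction n with
  | zero => simp [runMeasure_cylinderSet_zero]
  | succ n ih => rw [runMeasure_cylinderSet_succ, ih, prod_range_succ, mul_assoc]

/-- **Unfolding of the first step** of the run measure. -/
lemma runMeasure_eq_sum (σ : M.Strategy) (p : V) : M.runMeasure σ p =
    ∑ t, M.next σ [] p t • (M.runMeasure (σ.tail p) t).map (prepend p) := by
  classical
  have hsum : ∑ t, M.next σ [] p t = 1 := by
    rw [← tsum_fintype (L := .unconditional _)]; exact (M.next σ [] p).tsum_coe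
  have hprob : ∀ t, IsProbabilityMeasure ((M.runMeasure (σ.tail p) t).map (prepend p)) :=
    fun t => Measure.isProbabilityMeasure_map (measurable_prepend p).aemeasurable
  have hfin : IsFiniteMeasure
      (∑ t, M.next σ [] p t • (M.runMeasure (σ.tail p) t).map (prepend p)) := by
    constructor
    simp [hsum]
  refine ext_of_cylinderSet fun x n => ?_
  rw [runMeasure_cylinderSet]
  simp only [Measure.coe_finsetSum, Finset.sum_apply, Measure.smul_apply, smul_eq_mul,
    Measure.map_apply (measurable_prepend p) (measurableSet_cylinderSet x n)]
  cases n with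
  | zero =>
    have h0 : prepend p ⁻¹' cylinderSet x 0 = if x 0 = p then Set.univ else ∅ := by
      ext ρ
      split_ifs with h <;> simp [cylinderSet, prepend, h, eq_comm]
    rw [h0]
    split_ifs <;> simp [hsum]
  | succ n =>
    rw [prepend_preimage_cylinderSet]
    split_ifs with h
    · simp only [runMeasure_cylinderSet, prod_range_succ', next_tail, history_succ, ← h]
      simp only [one_mul, ite_mul, zero_mul, mul_ite, mul_zero, zero_add, sum_ite_eq, mem_univ,
        if_true]
      rw [mul_comm]
      rfl
    · simp

end RunMeasure

end MDP

/-! ### The lower bound: gluing strategies -/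

namespace MDP

/-- The strategy that makes its first move like `σ`
and then continues with `τ t` from the state `t` reached. -/
def Strategy.cons {V : Type*} {M : MDP V} (σ : M.Strategy) (τ : V → M.Strategy) : M.Strategy where
  move
    | [], s, hs => σ.move [] s hs
    | _ :: w, s, hs => (τ (w.headD s)).move w s hs
  edge_of_move
    | [], s, hs, t, h => σ.edge_of_move [] s hs t h
    | _ :: w, s, hs, t, h => (τ (w.headD s)).edge_of_move w s hs t h

lemma next_cons_nil {V : Type*} {M : MDP V} (σ : M.Strategy) (τ : V → M.Strategy) (p : V) :
    M.next (σ.cons τ) [] p = M.next σ [] p := rfl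

lemma next_cons {V : Type*} {M : MDP V} (σ : M.Strategy) (τ : V → M.Strategy) (p : V)
    (w : List V) (s : V) : M.next (σ.cons τ) (p :: w) s = M.next (τ (w.headD s)) w s := rfl

lemma energy_mono {V : Type*} (M : MDP V) (cost : V → V → ℤ) : Monotone (M.energy cost) := by
  rintro k l hkl ρ ⟨hρ, h⟩
  refine ⟨hρ, fun n => ?_⟩
  have := h n
  omega

lemma totalCost_prepend {V : Type*} (cost : V → V → ℤ) (p : V) (ρ : ℕ → V) (n : ℕ) :
    totalCost cost (prepend p ρ) (n + 1) = cost p (ρ 0) + totalCost cost ρ n := by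
  unfold totalCost
  rw [sum_range_succ', add_comm]
  rfl

lemma frequently_succ_iff {P : ℕ → Prop} : (∃ᶠ n in atTop, P (n + 1)) ↔ ∃ᶠ n in atTop, P n := by
  conv_rhs => rw [← map_add_atTop_eq_nat 1]
  rw [frequently_map]

lemma prepend_mem_runs {V : Type*} {M : MDP V} {p : V} {ρ : ℕ → V} (h : M.Edge p (ρ 0))
    (hρ : ρ ∈ M.runs) : prepend p ρ ∈ M.runs := by
  rintro (_ | n)
  · exact h
  · exact hρ n

lemma prepend_mem_energy {V : Type*} {M : MDP V} {cost : V → V → ℤ} {p : V} {ρ : ℕ → V} {k l : ℕ}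
    (h : M.Edge p (ρ 0)) (hk : (k : ℤ) ≤ l + cost p (ρ 0)) (hρ : ρ ∈ M.energy cost k) :
    prepend p ρ ∈ M.energy cost l := by
  refine ⟨prepend_mem_runs h hρ.1, ?_⟩
  rintro (_ | n)
  · simp [totalCost]
  · rw [totalCost_prepend]
    have := hρ.2 n
    omega

lemma prepend_mem_parityObj {V : Type*} {M : MDP V} {parity : V → ℕ} {p : V} {ρ : ℕ → V}
    (h : M.Edge p (ρ 0)) (hρ : ρ ∈ M.parityObj parity) : prepend p ρ ∈ M.parityObj parity := by
  refine ⟨prepend_mem_runs h hρ.1, ?_⟩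
  obtain ⟨c, hc, he⟩ := hρ.2
  refine ⟨c, ?_, he⟩
  have hset : {c : ℕ | ∃ᶠ n in atTop, parity (prepend p ρ n) = c} =
      {c : ℕ | ∃ᶠ n in atTop, parity (ρ n) = c} := by
    ext c
    exact frequently_succ_iff.symm
  rwa [hset]

/-- A run of positive mean payoff has bounded total losses. -/
lemma exists_mem_energy_of_mem_posMP {V : Type*} {M : MDP V} {cost : V → V → ℤ} {ρ : ℕ → V}
    (h : ρ ∈ M.posMP cost) : ∃ k, ρ ∈ M.energy cost k := by
  have h1 := eventually_lt_of_lt_liminf h.2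
  obtain ⟨N, hN⟩ := eventually_atTop.1 h1
  have h2 : ∀ n, N < n → 0 < totalCost cost ρ n := by
    intro n hn
    have h3 := hN n hn.le
    have h4 : (0 : ℝ) < 1 / (n : ℝ) * (totalCost cost ρ n : ℝ) := by exact_mod_cast h3
    have h5 : (0 : ℝ) < 1 / (n : ℝ) := by
      have : (0 : ℝ) < n := by exact_mod_cast (Nat.zero_le N).trans_lt hn
      positivity
    exact_mod_cast (pos_iff_pos_of_mul_pos h4).1 h5
  refine ⟨∑ n ∈ range (N + 1), (totalCost cost ρ n).natAbs, h.1, fun n => ?_⟩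
  rcases lt_or_ge N n with hn | hn
  · have := h2 n hn
    positivity
  · have : (totalCost cost ρ n).natAbs ≤ ∑ m ∈ range (N + 1), (totalCost cost ρ m).natAbs :=
      single_le_sum (f := fun m => (totalCost cost ρ m).natAbs) (fun _ _ => Nat.zero_le _)
        (mem_range.2 (Nat.lt_succ_of_le hn))
    omega

section LimitValue

variable {V : Type*} [Fintype V] [MeasurableSpace V] [DiscreteMeasurableSpace V]
  {M : MDP V} {cost : V → V → ℤ} {parity : V → ℕ}

/-- The run measure depends only on the moves after histories that start in the initial state. -/
lemma runMeasure_congr {σ τ : M.Strategy} {p : V}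
    (h : ∀ w s, w.headD s = p → M.next σ w s = M.next τ w s) :
    M.runMeasure σ p = M.runMeasure τ p := by
  classical
  refine ext_of_cylinderSet fun x n => ?_
  rw [runMeasure_cylinderSet, runMeasure_cylinderSet]
  split_ifs with hx
  · congr 1
    refine prod_congr rfl fun i _ => ?_
    rw [h]
    cases i with
    | zero => exact hx
    | succ i => rw [history_succ]; exact hx
  · simp

lemma runMeasure_cons (σ : M.Strategy) (τ : V → M.Strategy) (p : V) :
    M.runMeasure (σ.cons τ) p =
      ∑ t, M.next σ [] p t • (M.runMeasure (τ t) t).map (prepend p) := by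
  rw [runMeasure_eq_sum]
  refine sum_congr rfl fun t _ => ?_
  have h : M.runMeasure ((σ.cons τ).tail p) t = M.runMeasure (τ t) t := by
    refine runMeasure_congr fun w s hw => ?_
    rw [next_tail, next_cons, hw]
  rw [h, next_cons_nil]

lemma le_limitValue (k : ℕ) (σ : M.Strategy) (p : V) :
    M.runMeasure σ p (M.energy cost k ∩ M.parityObj parity) ≤ M.limitValue cost parity p :=
  le_iSup_of_le k (le_iSup (fun σ : M.Strategy =>
    M.runMeasure σ p (M.energy cost k ∩ M.parityObj parity)) σ)

lemma limitValue_le_one (p : V) : M.limitValue cost parity p ≤ 1 :=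
  iSup_le fun _ => iSup_le fun _ => prob_le_one

lemma exists_limitValue_le_add (σ : M.Strategy) (p : V) {ε : ENNReal} (hε : ε ≠ 0) :
    ∃ k, ∃ τ : M.Strategy, M.limitValue cost parity p ≤
      M.runMeasure τ p (M.energy cost k ∩ M.parityObj parity) + ε := by
  by_cases h0 : M.limitValue cost parity p = 0
  · exact ⟨0, σ, by simp [h0]⟩
  by_contra! hcon
  have h1 : M.limitValue cost parity p ≤ M.limitValue cost parity p - ε :=
    iSup_le fun k => iSup_le fun τ =>
      ENNReal.le_sub_of_add_le_right (by
        rintro rfl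
        simpa using hcon 0 σ) (hcon k τ).le
  exact absurd h1 (not_le.2 (ENNReal.sub_lt_self
    ((limitValue_le_one p).trans_lt ENNReal.one_lt_top).ne h0 hε))

/-- The limit value is at least the mean of the limit values of the successors,
whatever the first move. -/
lemma sum_mul_limitValue_le (σ : M.Strategy) (p : V) :
    ∑ t, M.next σ [] p t * M.limitValue cost parity t ≤ M.limitValue cost parity p := by
  refine ENNReal.le_of_forall_pos_le_add fun ε hε _ => ?_
  have hε' : (ε : ENNReal) ≠ 0 := by exact_mod_cast hε.ne'
  choose k τ hτ using fun t => exists_limitValue_le_add (cost := cost) (parity := parity) σ t hε'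
  -- enough initial energy to pay for the first edge, whichever it is
  let K : ℕ := ∑ t, (k t + (cost p t).natAbs)
  have hK : ∀ t, (k t : ℤ) ≤ K + cost p t := by
    intro t
    have := single_le_sum (f := fun t => k t + (cost p t).natAbs) (fun _ _ => Nat.zero_le _)
      (mem_univ t)
    change _ ≤ K at this
    omega
  have hsum : ∑ t, M.next σ [] p t = 1 := by
    rw [← tsum_fintype (L := .unconditional _)]; exact (M.next σ [] p).tsum_coe
  have h1 : ∑ t, M.next σ [] p t *
      M.runMeasure (τ t) t (M.energy cost (k t) ∩ M.parityObj parity) ≤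
      M.runMeasure (σ.cons τ) p (M.energy cost K ∩ M.parityObj parity) := by
    rw [runMeasure_cons]
    simp only [Measure.coe_finsetSum, Finset.sum_apply, Measure.smul_apply, smul_eq_mul]
    refine sum_le_sum fun t _ => ?_
    by_cases ht : M.next σ [] p t = 0
    · simp [ht]
    refine mul_le_mul' le_rfl
      (le_trans ?_ (Measure.le_map_apply (measurable_prepend p).aemeasurable _))
    refine measure_mono_ae ?_
    filter_upwards [ae_zero_eq (M := M) (σ := τ t) (p := t)] with ρ h0 hρ
    have he : M.Edge p (ρ 0) := h0 ▸ edge_of_next ht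
    exact ⟨prepend_mem_energy he (h0 ▸ hK t) hρ.1, prepend_mem_parityObj he hρ.2⟩
  calc ∑ t, M.next σ [] p t * M.limitValue cost parity t
      ≤ ∑ t, M.next σ [] p t *
        (M.runMeasure (τ t) t (M.energy cost (k t) ∩ M.parityObj parity) + ε) := by
        gcongr with t; exact hτ t
    _ = ∑ t, M.next σ [] p t *
        M.runMeasure (τ t) t (M.energy cost (k t) ∩ M.parityObj parity) + ε := by
        simp only [mul_add, sum_add_distrib, ← Finset.sum_mul, hsum, one_mul]
    _ ≤ M.limitValue cost parity p + ε := by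
        gcongr
        exact h1.trans (le_limitValue K _ p)

lemma one_le_limitValue_of_mem_setA {q : V} (hq : q ∈ M.setA cost parity) :
    1 ≤ M.limitValue cost parity q := by
  obtain ⟨k, σ, h⟩ := hq
  exact h ▸ le_limitValue k σ q

lemma one_le_limitValue_of_mem_setB {q : V} (hq : q ∈ M.setB cost parity) :
    1 ≤ M.limitValue cost parity q := by
  obtain ⟨σ, h⟩ := hq
  have hsub : M.posMP cost ∩ M.parityObj parity ⊆
      ⋃ k, (M.energy cost k ∩ M.parityObj parity) := by
    rintro ρ ⟨h1, h2⟩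
    obtain ⟨k, hk⟩ := exists_mem_energy_of_mem_posMP h1
    exact Set.mem_iUnion.2 ⟨k, hk, h2⟩
  have hmono : Monotone fun k => M.energy cost k ∩ M.parityObj parity :=
    fun k l hkl => Set.inter_subset_inter_left _ (energy_mono M cost hkl)
  rw [← h]
  refine (measure_mono hsub).trans ?_
  rw [hmono.measure_iUnion]
  exact iSup_le fun k => le_limitValue k σ q

lemma runMeasure_reach_within_le (n : ℕ) (σ : M.Strategy) (p : V) :
    M.runMeasure σ p {ρ | ∃ m ≤ n, ρ m ∈ M.setA cost parity ∪ M.setB cost parity} ≤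
      M.limitValue cost parity p := by
  set T := M.setA cost parity ∪ M.setB cost parity
  induction n generalizing σ p with
  | zero =>
    by_cases hp : p ∈ T
    · exact prob_le_one.trans
        (hp.elim one_le_limitValue_of_mem_setA one_le_limitValue_of_mem_setB)
    · refine le_of_eq_of_le ?_ zero_le
      rw [measure_eq_zero_iff_ae_notMem]
      filter_upwards [ae_zero_eq (M := M) (σ := σ) (p := p)] with ρ h0
      rintro ⟨m, hm, hmT⟩
      obtain rfl : m = 0 := by omega
      exact hp (h0 ▸ hmT)
  | succ n ih =>
    by_cases hp : p ∈ T
    · exact prob_le_one.trans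
        (hp.elim one_le_limitValue_of_mem_setA one_le_limitValue_of_mem_setB)
    · have hm : MeasurableSet {ρ : ℕ → V | ∃ m ≤ n + 1, ρ m ∈ T} := by
        have : {ρ : ℕ → V | ∃ m ≤ n + 1, ρ m ∈ T} =
            ⋃ m, ⋃ (_ : m ≤ n + 1), (fun ρ : ℕ → V => ρ m) ⁻¹' T := by
          ext ρ; simp
        rw [this]
        exact .iUnion fun m => .iUnion fun _ => measurable_pi_apply m (.of_discrete)
      rw [runMeasure_eq_sum]
      simp only [Measure.coe_finsetSum, Finset.sum_apply, Measure.smul_apply, smul_eq_mul,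
        Measure.map_apply (measurable_prepend p) hm]
      refine le_trans (sum_le_sum fun t _ => ?_) (sum_mul_limitValue_le σ p)
      refine mul_le_mul' le_rfl ((measure_mono ?_).trans (ih (σ.tail p) t))
      rintro ρ ⟨_ | m, hm, hmT⟩
      · exact absurd hmT hp
      · exact ⟨m, by omega, hmT⟩

lemma runMeasure_reach_le_limitValue (σ : M.Strategy) (p : V) :
    M.runMeasure σ p (M.reach (M.setA cost parity ∪ M.setB cost parity)) ≤
      M.limitValue cost parity p := by
  have hsub : M.reach (M.setA cost parity ∪ M.setB cost parity) ⊆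
      ⋃ n : ℕ, {ρ | ∃ m ≤ n, ρ m ∈ M.setA cost parity ∪ M.setB cost parity} := by
    rintro ρ ⟨-, n, hn⟩
    exact Set.mem_iUnion.2 ⟨n, n, le_rfl, hn⟩
  have hmono : Monotone fun n : ℕ =>
      {ρ : ℕ → V | ∃ m ≤ n, ρ m ∈ M.setA cost parity ∪ M.setB cost parity} :=
    fun n l hnl ρ ⟨m, hm, h⟩ => ⟨m, hm.trans hnl, h⟩
  refine (measure_mono hsub).trans ?_
  rw [hmono.measure_iUnion]
  exact iSup_le fun n => runMeasure_reach_within_le n σ p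

end LimitValue

end MDP

/-! ### The Bellman operator on an end component -/

/-- For a monotone map `T` that commutes with the addition of constants and satisfies a
Harnack-type inequality on `C` (`hspan`: the oscillation of each almost-superharmonic function is
bounded), there is a function that is superharmonic on `C`, or one that `T` strictly increases
on `C`. -/
lemma exists_superharmonic_or_strictly_subharmonic {V : Type*} [Finite V] {C : Set V}
    {T : (V → ℝ) → V → ℝ} (hmono : Monotone T) (hadd : ∀ u c s, T (fun t => u t + c) s = T u s + c)
    (hoff : ∀ u, ∀ s ∉ C, T u s = u s)
    (hspan : ∀ K, ∃ D, ∀ u : V → ℝ, (∀ s ∈ C, T u s ≤ u s + K) →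
      ∀ s ∈ C, ∀ t ∈ C, u t ≤ u s + D) :
    (∃ h, ∀ s ∈ C, T h s ≤ h s) ∨ ∃ h η, 0 < η ∧ ∀ s ∈ C, h s + η ≤ T h s := by
  -- `u n` is the value of the optimal stopping problem with horizon `n`
  let u : ℕ → V → ℝ := fun n =>
    Nat.rec (motive := fun _ => V → ℝ) (fun _ => 0) (fun _ v s => max 0 (T v s)) n
  have u_zero : ∀ s, u 0 s = 0 := fun s => rfl
  have u_succ : ∀ n s, u (n + 1) s = max 0 (T (u n) s) := fun n s => rfl
  have u_mono : Monotone u := by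
    refine monotone_nat_of_le_succ fun n => ?_
    induction n with
    | zero => exact fun s => le_max_left _ _
    | succ n ih => exact fun s => max_le_max le_rfl (hmono ih s)
  have u_nonneg : ∀ n s, 0 ≤ u n s := fun n s => u_mono (Nat.zero_le n) s
  have u_off : ∀ n, ∀ s ∉ C, u n s = 0 := by
    intro n s hs
    induction n with
    | zero => rfl
    | succ n ih => rw [u_succ, hoff _ s hs, ih, max_self]
  obtain ⟨K, hK⟩ : ∃ K, ∀ s, T (u 0) s ≤ K := by
    obtain ⟨K, hK⟩ := (Set.finite_range (T (u 0))).bddAbove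
    exact ⟨K, fun s => hK ⟨s, rfl⟩⟩
  have u_succ_le : ∀ n s, u (n + 1) s ≤ u n s + max 0 K := by
    intro n
    induction n with
    | zero =>
      intro s
      rw [u_succ, u_zero, zero_add]
      exact max_le_max le_rfl (hK s)
    | succ n ih =>
      intro s
      have h1 : T (u (n + 1)) s ≤ T (u n) s + max 0 K := by
        rw [← hadd]; exact hmono ih s
      rw [u_succ (n + 1), max_le_iff]
      have h2 : T (u n) s ≤ u (n + 1) s := le_max_right _ _
      have h3 := u_nonneg (n + 1) s
      have h4 : (0 : ℝ) ≤ max 0 K := le_max_left _ _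
      constructor <;> linarith
  obtain ⟨D, hD⟩ := hspan (max 0 K)
  have u_span : ∀ n, ∀ s ∈ C, ∀ t ∈ C, u n t ≤ u n s + D :=
    fun n => hD (u n) fun s _ => (le_max_right _ _).trans (u_succ_le n s)
  by_cases hbdd : ∃ B : ℝ, ∀ n s, u n s ≤ B
  · left
    obtain ⟨B, hB⟩ := hbdd
    have hbd : ∀ s, BddAbove (Set.range fun n => u n s) := by
      rintro s
      refine ⟨B, ?_⟩
      rintro _ ⟨n, rfl⟩
      exact hB n s
    refine ⟨fun s => ⨆ n, u n s, fun s _ => le_of_forall_pos_le_add fun ε hε => ?_⟩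
    have h1 : ∀ᶠ n in atTop, ∀ t, (⨆ n, u n t) < u n t + ε := by
      rw [eventually_all]
      intro t
      have h2 := tendsto_atTop_ciSup (fun m n hmn => u_mono hmn t) (hbd t)
      filter_upwards [h2.eventually (lt_mem_nhds (sub_lt_self (⨆ n, u n t) hε))] with n hn
      linarith
    obtain ⟨n, hn⟩ := h1.exists
    calc T (fun t => ⨆ n, u n t) s ≤ T (fun t => u n t + ε) s := hmono (fun t => (hn t).le) s
      _ = T (u n) s + ε := hadd _ _ _
      _ ≤ u (n + 1) s + ε := by gcongr; exact le_max_right _ _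
      _ ≤ (⨆ n, u n s) + ε := by gcongr; exact le_ciSup (hbd s) (n + 1)
  · right
    push Not at hbdd
    obtain ⟨m, s₁, hm⟩ := hbdd (max 0 D + 2)
    have hD0 : (0 : ℝ) ≤ max 0 D := le_max_left _ _
    have hDD : D ≤ max 0 D := le_max_right _ _
    have hs₁ : s₁ ∈ C := by
      by_contra hs
      rw [u_off m s₁ hs] at hm
      linarith
    have hm0 : (0 : ℝ) < m := by
      rcases Nat.eq_zero_or_pos m with rfl | h
      · rw [u_zero] at hm
        linarith
      · exact_mod_cast h
    have hbig : ∀ s ∈ C, 2 < u m s := by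
      intro s hs
      have := u_span m s hs s₁ hs₁
      linarith
    -- the maximum is not attained at `i = 0`, so applying `T` shifts the index and gains `1 / m`
    let w : V → ℝ := fun s =>
      (range (m + 1)).sup' nonempty_range_add_one fun i => u i s - (i : ℝ) / m
    refine ⟨w, 1 / m, by positivity, fun s hs => ?_⟩
    obtain ⟨i, him, hi⟩ := exists_mem_eq_sup' (nonempty_range_add_one (n := m))
      fun i => u i s - (i : ℝ) / m
    have hw : w s = u i s - (i : ℝ) / m := hi
    have hwle : ∀ j, j ≤ m → ∀ t, u j t - (j : ℝ) / m ≤ w t := by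
      intro j hj t
      exact le_sup' (fun i => u i t - (i : ℝ) / m) (mem_range.2 (Nat.lt_succ_of_le hj))
    have hw1 : 1 < w s := by
      have h1 := hwle m le_rfl s
      rw [div_self hm0.ne'] at h1
      have := hbig s hs
      linarith
    cases i with
    | zero =>
      rw [u_zero] at hw
      simp only [Nat.cast_zero, zero_div, sub_zero] at hw
      linarith
    | succ j =>
      have hj : j ≤ m := by
        have := mem_range.1 him
        omega
      have hpos : (0 : ℝ) ≤ ((j + 1 : ℕ) : ℝ) / m := by positivity
      have hu : u (j + 1) s = T (u j) s := by
        rw [u_succ]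
        refine max_eq_right (le_of_not_gt fun hneg => ?_)
        rw [u_succ, max_eq_left hneg.le] at hw
        linarith
      have hT : T (fun t => u j t + -((j : ℝ) / m)) s ≤ T w s :=
        hmono (fun t => by linarith [hwle j hj t]) s
      rw [hadd, ← hu] at hT
      rw [hw]
      push_cast
      rw [add_div]
      linarith

namespace MDP

/-- `U` is the set of edges of an end component: it is a strongly connected set of edges, and at
the probabilistic states that it touches it consists of the edges of positive probability. -/
structure IsEndComponent {V : Type*} (M : MDP V) (U : V → V → Prop) : Prop where
  edge : ∀ s t, U s t → M.Edge s t
  exists_succ : ∀ s t, U s t → ∃ r, U t r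
  connected : ∀ s s' t t', U s s' → U t t' → Relation.ReflTransGen U s t
  iff_prob : ∀ s (hs : s ∉ M.controlled), (∃ t, U s t) → ∀ t, U s t ↔ M.prob s hs t ≠ 0

/-- The Bellman operator for the total cost in the subarena with the edges `U`
(the identity at the states without `U`-successors). The supremum is over a finite nonempty set. -/
noncomputable def bellman {V : Type*} [Fintype V] (M : MDP V) (cost : V → V → ℤ) (U : V → V → Prop)
    (h : V → ℝ) (s : V) : ℝ :=
  open Classical in
  if ∃ t, U s t then
    if hs : s ∈ M.controlled then ⨆ t : {t // U s t}, (cost s t + h t)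
    else ∑ t, (M.prob s hs t).toReal * (cost s t + h t)
  else h s

section Bellman

variable {V : Type*} [Fintype V] {M : MDP V} {cost : V → V → ℤ} {U : V → V → Prop}

lemma sum_toReal_pmf (q : PMF V) : ∑ t, (q t).toReal = 1 := by
  rw [← ENNReal.toReal_sum fun t _ => q.apply_ne_top t, ← tsum_fintype (L := .unconditional _),
    q.tsum_coe, ENNReal.toReal_one]

lemma bellman_of_controlled {s t : V} (hs : s ∈ M.controlled) (hU : U s t) (h : V → ℝ) :
    bellman M cost U h s = ⨆ t : {t // U s t}, (cost s t + h t) := by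
  rw [bellman, if_pos ⟨t, hU⟩, dif_pos hs]

lemma bellman_of_not_controlled {s t : V} (hs : s ∉ M.controlled) (hU : U s t) (h : V → ℝ) :
    bellman M cost U h s = ∑ t, (M.prob s hs t).toReal * (cost s t + h t) := by
  rw [bellman, if_pos ⟨t, hU⟩, dif_neg hs]

lemma le_bellman_of_controlled {s t : V} (hs : s ∈ M.controlled) (hU : U s t) (h : V → ℝ) :
    cost s t + h t ≤ bellman M cost U h s := by
  rw [bellman_of_controlled hs hU]
  exact le_ciSup (f := fun t : {t // U s t} => (cost s t + h t : ℝ)) (Set.finite_range _).bddAbove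
    ⟨t, hU⟩

lemma bellman_mono : Monotone (bellman M cost U) := by
  intro u v huv s
  unfold bellman
  split_ifs with h hs
  · exact ciSup_mono (Set.finite_range _).bddAbove fun t => by gcongr; exact huv t
  · gcongr with t
    exact huv t
  · exact huv s

lemma bellman_add (u : V → ℝ) (c : ℝ) (s : V) :
    bellman M cost U (fun t => u t + c) s = bellman M cost U u s + c := by
  unfold bellman
  split_ifs with h hs
  · have : Nonempty {t // U s t} := ⟨⟨h.choose, h.choose_spec⟩⟩
    rw [ciSup_add (Set.finite_range _).bddAbove]
    simp only [add_assoc]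
  · simp only [← add_assoc, mul_add, sum_add_distrib, ← Finset.sum_mul, sum_toReal_pmf, one_mul]
  · rfl

/-- Almost-superharmonic functions on an end component have bounded oscillation. -/
lemma bellman_span (hU : M.IsEndComponent U) (K : ℝ) : ∃ D, ∀ u : V → ℝ,
    (∀ s ∈ {s | ∃ t, U s t}, bellman M cost U u s ≤ u s + K) →
      ∀ s ∈ {s | ∃ t, U s t}, ∀ t ∈ {s | ∃ t, U s t}, u t ≤ u s + D := by
  -- along an edge, the excess over the minimum `m` of `u` grows in a controlled way
  have key : ∀ s t, Relation.ReflTransGen U s t → ∃ D, ∀ u : V → ℝ, ∀ m,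
      (∀ r, (∃ t, U r t) → m ≤ u r) → (∀ r, (∃ t, U r t) → bellman M cost U u r ≤ u r + K) →
      u s = m → u t ≤ m + D := by
    intro s t hst
    induction hst with
    | refl => exact ⟨0, fun u m _ _ h => by simp [h]⟩
    | @tail b c _ hbc ih =>
      obtain ⟨D, hD⟩ := ih
      by_cases hb : b ∈ M.controlled
      · refine ⟨D + K - cost b c, fun u m h1 h2 h3 => ?_⟩
        have h4 := hD u m h1 h2 h3
        have h5 := h2 b ⟨c, hbc⟩
        have h6 := le_bellman_of_controlled (cost := cost) hb hbc u
        linarith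
      · have hc : M.prob b hb c ≠ 0 := (hU.iff_prob b hb ⟨c, hbc⟩ c).1 hbc
        have hc' : 0 < (M.prob b hb c).toReal := ENNReal.toReal_pos hc (PMF.apply_ne_top _ _)
        refine ⟨(D + K - ∑ t, (M.prob b hb t).toReal * cost b t) / (M.prob b hb c).toReal,
          fun u m h1 h2 h3 => ?_⟩
        have h4 := hD u m h1 h2 h3
        have h5 := h2 b ⟨c, hbc⟩
        rw [bellman_of_not_controlled hb hbc] at h5
        have h6 : (M.prob b hb c).toReal * (u c - m) ≤ ∑ t, (M.prob b hb t).toReal * (u t - m) := by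
          refine single_le_sum (f := fun t => (M.prob b hb t).toReal * (u t - m)) (fun t _ => ?_)
            (mem_univ c)
          by_cases ht : M.prob b hb t = 0
          · simp [ht]
          · refine mul_nonneg ENNReal.toReal_nonneg (sub_nonneg.2 (h1 t ?_))
            exact hU.exists_succ b t ((hU.iff_prob b hb ⟨c, hbc⟩ t).2 ht)
        simp only [mul_add, mul_sub, sum_add_distrib, sum_sub_distrib, ← Finset.sum_mul,
          sum_toReal_pmf, one_mul] at h5 h6
        rw [← sub_le_iff_le_add', le_div_iff₀ hc']
        linarith
  choose! D hD using key
  obtain ⟨B, hB⟩ := (Set.finite_range fun x : V × V => D x.1 x.2).bddAbove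
  refine ⟨B, fun u hu s hs t ht => ?_⟩
  obtain ⟨r, hr, hmin⟩ := Set.exists_min_image {s | ∃ t, U s t} u (Set.toFinite _) ⟨s, hs⟩
  have h1 := hD r t (hU.connected _ _ _ _ hr.choose_spec ht.choose_spec) u (u r) hmin hu rfl
  have h2 : D r t ≤ B := hB ⟨(r, t), rfl⟩
  have h3 := hmin s hs
  linarith

lemma bellman_dichotomy (hU : M.IsEndComponent U) (cost : V → V → ℤ) :
    (∃ h, ∀ s, (∃ t, U s t) → bellman M cost U h s ≤ h s) ∨
      ∃ h η, 0 < η ∧ ∀ s, (∃ t, U s t) → h s + η ≤ bellman M cost U h s :=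
  exists_superharmonic_or_strictly_subharmonic (C := {s | ∃ t, U s t}) bellman_mono bellman_add
    (fun _ _ hs => if_neg hs) (bellman_span hU)

end Bellman

end MDP

/-! ### Almost sure behaviour of sums along a run -/

namespace MDP

lemma measurable_apply_piLE {V : Type*} [MeasurableSpace V] {i n : ℕ} (h : i ≤ n) :
    Measurable[Filtration.piLE (X := fun _ : ℕ => V) n] fun ρ : ℕ → V => ρ i := by
  rw [Filtration.piLE_eq_comap_frestrictLe]
  exact (measurable_pi_apply (X := fun _ : Iic n => V) ⟨i, mem_Iic.2 h⟩).comp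
    (comap_measurable (Preorder.frestrictLe (π := fun _ : ℕ => V) n))

lemma exists_abs_le {V : Type*} [Finite V] (G : V → V → ℝ) : ∃ K, 0 < K ∧ ∀ s t, |G s t| ≤ K := by
  obtain ⟨K, hK⟩ := (Set.finite_range fun x : V × V => |G x.1 x.2|).bddAbove
  exact ⟨max K 1, by positivity, fun s t => (hK ⟨(s, t), rfl⟩).trans (le_max_left _ _)⟩

section AlmostSure

variable {V : Type*} [Fintype V] [MeasurableSpace V] [DiscreteMeasurableSpace V]
  {M : MDP V} {σ : M.Strategy} {p : V}

lemma measurable_pair_piLE (G : V → V → ℝ) {i n : ℕ} (h : i < n) :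
    Measurable[Filtration.piLE (X := fun _ : ℕ => V) n]
      fun ρ : ℕ → V => G (ρ i) (ρ (i + 1)) :=
  (Measurable.of_discrete (f := fun x : V × V => G x.1 x.2)).comp
    (g := fun x : V × V => G x.1 x.2) (f := fun ρ : ℕ → V => (ρ i, ρ (i + 1)))
    (Measurable.prodMk (measurable_apply_piLE h.le) (measurable_apply_piLE h))

/-- An edge whose probability is bounded below is almost surely taken infinitely often
on the runs that visit its source infinitely often. -/
lemma ae_frequently_edge {s t : V} {c : ℝ} (hc : 0 < c)
    (h : ∀ w, c ≤ (M.next σ w s t).toReal) :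
    ∀ᵐ ρ ∂M.runMeasure σ p, (∃ᶠ n in atTop, ρ n = s) →
      ∃ᶠ n in atTop, ρ n = s ∧ ρ (n + 1) = t := by
  classical
  let G : V → V → ℝ := fun a b => if a = s ∧ b = t then 1 else 0
  -- `A (n + 1)` is the event that the edge is taken at time `n`, which is known at time `n + 1`
  let A : ℕ → Set (ℕ → V) := fun n => {ρ | ∃ m, n = m + 1 ∧ ρ m = s ∧ ρ (m + 1) = t}
  have hA : ∀ n, A (n + 1) = {ρ | ρ n = s ∧ ρ (n + 1) = t} := by
    intro n
    ext ρ
    simp [A]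
  have hind : ∀ n, (A (n + 1)).indicator (1 : (ℕ → V) → ℝ) = fun ρ => G (ρ n) (ρ (n + 1)) := by
    intro n
    ext ρ
    simp [hA, G, Set.indicator_apply]
  have hmeas : ∀ n, MeasurableSet[Filtration.piLE (X := fun _ : ℕ => V) n] (A n) := by
    rintro (_ | n)
    · simp [A]
    · rw [hA]
      exact (measurable_apply_piLE n.le_succ (measurableSet_singleton s)).inter
        (measurable_apply_piLE le_rfl (measurableSet_singleton t))
  have hstep : ∀ᵐ ρ ∂M.runMeasure σ p, ∀ n, ({ρ | ρ n = s} : Set (ℕ → V)).indicator (fun _ => c) ρ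
      ≤ ((M.runMeasure σ p)[(A (n + 1)).indicator (1 : (ℕ → V) → ℝ) |
        Filtration.piLE (X := fun _ : ℕ => V) n]) ρ := by
    rw [ae_all_iff]
    intro n
    rw [hind]
    filter_upwards [condExp_step (M := M) (σ := σ) (p := p) G n] with ρ hρ
    rw [hρ]
    by_cases hs : ρ n = s
    · simpa [G, hs] using h _
    · simp [G, hs]
  filter_upwards [ae_mem_limsup_atTop_iff (M.runMeasure σ p) hmeas, hstep] with ρ h1 h2 h3
  have h4 : Tendsto (fun n => ∑ k ∈ range n,
      ({ρ | ρ k = s} : Set (ℕ → V)).indicator (fun _ => c) ρ) atTop atTop := by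
    have h5 := Set.limsup_eq_tendsto_sum_indicator_atTop hc
      fun k => ({ρ | ρ k = s} : Set (ℕ → V))
    have h6 : ρ ∈ limsup (fun k => ({ρ | ρ k = s} : Set (ℕ → V))) atTop :=
      mem_limsup_iff_frequently_mem.2 h3
    rw [h5] at h6
    exact h6
  have h7 := mem_limsup_iff_frequently_mem.1
    (h1.2 (tendsto_atTop_mono (fun n => sum_le_sum fun k _ => h2 k) h4))
  rw [← frequently_succ_iff] at h7
  simpa only [hA, Set.mem_ofPred_eq] using h7

/-- If the conditional means of the increments `g` are nonnegative, then on almost every run where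
the sum of the increments is bounded above, the increments eventually vanish. -/
lemma ae_eventually_eq_zero {g : V → V → ℝ}
    (hg : ∀ w s, 0 ≤ ∑ t, (M.next σ w s t).toReal * g s t) :
    ∀ᵐ ρ ∂M.runMeasure σ p, BddAbove (Set.range fun n => ∑ i ∈ range n, g (ρ i) (ρ (i + 1))) →
      ∀ᶠ n in atTop, g (ρ n) (ρ (n + 1)) = 0 := by
  let f : ℕ → (ℕ → V) → ℝ := fun n ρ => ∑ i ∈ range n, g (ρ i) (ρ (i + 1))
  have hdiff : ∀ n, f (n + 1) - f n = fun ρ => g (ρ n) (ρ (n + 1)) := by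
    intro n
    ext ρ
    simp [f, sum_range_succ]
  have hsub : Submartingale f (Filtration.piLE (X := fun _ : ℕ => V)) (M.runMeasure σ p) := by
    refine submartingale_of_condExp_sub_nonneg_nat ?_ ?_ ?_
    · intro n
      exact (Finset.measurable_sum _ fun i hi =>
        measurable_pair_piLE g (mem_range.1 hi)).stronglyMeasurable
    · intro n
      exact integrable_finsetSum _ fun i _ => integrable_pair _ g i
    · intro n
      rw [hdiff]
      filter_upwards [condExp_step (M := M) (σ := σ) (p := p) g n] with ρ hρ
      rw [hρ]
      exact hg _ _
  obtain ⟨K, hK, hgK⟩ := exists_abs_le g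
  have hbdd : ∀ᵐ ρ ∂M.runMeasure σ p, ∀ i, |f (i + 1) ρ - f i ρ| ≤ (⟨K, hK.le⟩ : NNReal) := by
    refine .of_forall fun ρ i => ?_
    rw [← Pi.sub_apply, hdiff]
    exact hgK _ _
  filter_upwards [hsub.bddAbove_iff_exists_tendsto hbdd] with ρ hρ hb
  obtain ⟨c, hc⟩ := hρ.1 hb
  have h0 : Tendsto (fun n => g (ρ n) (ρ (n + 1))) atTop (nhds 0) := by
    have := ((tendsto_add_atTop_iff_nat 1).2 hc).sub hc
    rw [sub_self] at this
    refine this.congr fun n => ?_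
    rw [← Pi.sub_apply, hdiff]
  -- the increments have finitely many values
  have hfin : ({x | ∃ s t, g s t = x} \ {0}).Finite :=
    ((Set.finite_range fun x : V × V => g x.1 x.2).subset
      (by rintro x ⟨s, t, rfl⟩; exact ⟨(s, t), rfl⟩)).subset Set.sdiff_subset
  have hnhds : ({x | ∃ s t, g s t = x} \ {0})ᶜ ∈ nhds (0 : ℝ) :=
    hfin.isClosed.isOpen_compl.mem_nhds (by simp)
  filter_upwards [h0 hnhds] with n hn
  by_contra hne
  exact hn ⟨⟨_, _, rfl⟩, hne⟩

/-- If the conditional means of the increments `g` are at least `η`, then almost surely the sum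
of the increments grows at least linearly. -/
lemma ae_linear_growth {g : V → V → ℝ} {η : ℝ} (hη : 0 < η)
    (hg : ∀ w s, η ≤ ∑ t, (M.next σ w s t).toReal * g s t) :
    ∀ᵐ ρ ∂M.runMeasure σ p, ∃ B : ℝ, ∀ n : ℕ,
      η / 2 * n - B ≤ ∑ i ∈ range n, g (ρ i) (ρ (i + 1)) := by
  obtain ⟨K, hK, hgK⟩ := exists_abs_le fun s t => η / 2 - g s t
  -- for small `θ`, the process `exp (θ * ∑ (η / 2 - g))` is a supermartingale
  obtain ⟨θ, hθ, hθ1, hθ2⟩ : ∃ θ : ℝ, 0 < θ ∧ θ * K ≤ 1 ∧ θ * K ^ 2 ≤ η / 2 := by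
    refine ⟨min (1 / K) (η / 2 / K ^ 2), by positivity, ?_, ?_⟩
    · rw [← le_div_iff₀ hK]; exact min_le_left _ _
    · rw [← le_div_iff₀ (by positivity)]; exact min_le_right _ _
  let x : V → V → ℝ := fun s t => θ * (η / 2 - g s t)
  have hx : ∀ s t, |x s t| ≤ θ * K := by
    intro s t
    rw [abs_mul, abs_of_pos hθ]
    exact mul_le_mul_of_nonneg_left (hgK s t) hθ.le
  have hmean : ∀ w s, ∑ t, (M.next σ w s t).toReal * Real.exp (x s t) ≤ 1 := by
    intro w s
    have h1 : ∀ t, Real.exp (x s t) ≤ 1 + θ * (η / 2) + θ * (θ * K ^ 2) - θ * g s t := by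
      intro t
      have h2 := (abs_le.1 (Real.abs_exp_sub_one_sub_id_le ((hx s t).trans hθ1))).2
      have h3 : x s t ^ 2 ≤ (θ * K) ^ 2 := sq_le_sq' (abs_le.1 (hx s t)).1 (abs_le.1 (hx s t)).2
      have h4 : x s t = θ * (η / 2) - θ * g s t := by ring
      nlinarith
    calc ∑ t, (M.next σ w s t).toReal * Real.exp (x s t)
        ≤ ∑ t, (M.next σ w s t).toReal *
          (1 + θ * (η / 2) + θ * (θ * K ^ 2) - θ * g s t) := by
          gcongr with t
          exact h1 t
      _ = 1 + θ * (η / 2) + θ * (θ * K ^ 2) -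
          θ * ∑ t, (M.next σ w s t).toReal * g s t := by
          simp only [mul_sub, sum_sub_distrib, ← Finset.sum_mul, sum_toReal_pmf, one_mul,
            mul_sum]
          congr 1
          exact sum_congr rfl fun t _ => by ring
      _ ≤ 1 := by
          have h2 := mul_le_mul_of_nonneg_left (hg w s) hθ.le
          have h3 := mul_le_mul_of_nonneg_left hθ2 hθ.le
          linarith
  let Z : ℕ → (ℕ → V) → ℝ := fun n ρ => Real.exp (∑ i ∈ range n, x (ρ i) (ρ (i + 1)))
  have hZsucc : ∀ n, Z (n + 1) = Z n * fun ρ => Real.exp (x (ρ n) (ρ (n + 1))) := by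
    intro n
    ext ρ
    simp only [Z, sum_range_succ, Real.exp_add, Pi.mul_apply]
  have hZmeas : ∀ n, Measurable[Filtration.piLE (X := fun _ : ℕ => V) n] (Z n) := fun n =>
    Real.measurable_exp.comp (Finset.measurable_sum _ fun i hi =>
      measurable_pair_piLE x (mem_range.1 hi))
  have hZint : ∀ n, Integrable (Z n) (M.runMeasure σ p) := by
    intro n
    refine Integrable.of_bound ((hZmeas n).mono
      ((Filtration.piLE (X := fun _ : ℕ => V)).le n) le_rfl).aestronglyMeasurable
      (Real.exp (n * (θ * K))) (.of_forall fun ρ => ?_)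
    rw [Real.norm_eq_abs, Real.abs_exp, Real.exp_le_exp]
    calc ∑ i ∈ range n, x (ρ i) (ρ (i + 1)) ≤ ∑ i ∈ range n, θ * K :=
          sum_le_sum fun i _ => (le_abs_self _).trans (hx _ _)
      _ = n * (θ * K) := by simp
  have hsup : Supermartingale Z (Filtration.piLE (X := fun _ : ℕ => V)) (M.runMeasure σ p) := by
    refine supermartingale_nat (fun n => (hZmeas n).stronglyMeasurable) hZint fun n => ?_
    have h1 := condExp_mul_of_stronglyMeasurable_left (μ := M.runMeasure σ p)
      (m := Filtration.piLE (X := fun _ : ℕ => V) n) (f := Z n)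
      (g := fun ρ => Real.exp (x (ρ n) (ρ (n + 1)))) (hZmeas n).stronglyMeasurable
      (hZsucc n ▸ hZint (n + 1)) (integrable_pair _ (fun s t => Real.exp (x s t)) n)
    rw [hZsucc]
    filter_upwards [h1, condExp_step (M := M) (σ := σ) (p := p) (fun s t => Real.exp (x s t)) n]
      with ρ h2 h3
    rw [h2, Pi.mul_apply, h3]
    exact mul_le_of_le_one_right (Real.exp_pos _).le (hmean _ _)
  have hL1 : ∀ n, eLpNorm ((-Z) n) 1 (M.runMeasure σ p) ≤ (1 : NNReal) := by
    intro n
    have h1 : ∫ ρ, Z n ρ ∂M.runMeasure σ p ≤ 1 := by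
      have h2 := hsup.setIntegral_le (Nat.zero_le n) MeasurableSet.univ
      simpa [Z] using h2
    rw [Pi.neg_apply, eLpNorm_neg, eLpNorm_one_eq_lintegral_enorm,
      ← ofReal_integral_norm_eq_lintegral_enorm (hZint n)]
    have h3 : ∀ ρ, ‖Z n ρ‖ = Z n ρ := fun ρ => by
      rw [Real.norm_eq_abs, Real.abs_exp]
    simp only [h3]
    exact (ENNReal.ofReal_le_ofReal h1).trans (by simp)
  filter_upwards [hsup.neg.exists_ae_tendsto_of_bdd hL1] with ρ hρ
  obtain ⟨c, hc⟩ := hρ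
  obtain ⟨R, hR⟩ := hc.neg.bddAbove_range
  refine ⟨Real.log (max R 1) / θ, fun n => ?_⟩
  have h1 : Z n ρ ≤ max R 1 := (hR ⟨n, by simp⟩).trans (le_max_left _ _)
  have h2 : ∑ i ∈ range n, x (ρ i) (ρ (i + 1)) ≤ Real.log (max R 1) := by
    rwa [Real.le_log_iff_exp_le (by positivity)]
  rw [← mul_sum, ← le_div_iff₀' hθ, sum_sub_distrib] at h2
  simp only [sum_const, card_range, nsmul_eq_mul] at h2
  linarith

end AlmostSure

end MDP

/-! ### End components and almost sure winning -/

namespace MDP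

/-- The edges that `ρ` takes infinitely often. -/
def recurrentEdge {V : Type*} (ρ : ℕ → V) (s t : V) : Prop :=
  ∃ᶠ n in atTop, ρ n = s ∧ ρ (n + 1) = t

section Recurrence

variable {V : Type*} [Finite V]

lemma frequently_exists_iff {P : V → ℕ → Prop} :
    (∃ᶠ n in atTop, ∃ v, P v n) ↔ ∃ v, ∃ᶠ n in atTop, P v n := by
  simp only [Filter.Frequently, not_exists, eventually_all, not_forall]

lemma frequently_eq_iff (ρ : ℕ → V) (s : V) :
    (∃ᶠ n in atTop, ρ n = s) ↔ ∃ t, recurrentEdge ρ s t := by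
  unfold recurrentEdge
  rw [← frequently_exists_iff]
  simp

lemma eventually_recurrentEdge (ρ : ℕ → V) :
    ∀ᶠ n in atTop, recurrentEdge ρ (ρ n) (ρ (n + 1)) := by
  have h : ∀ s t, ∀ᶠ n in atTop, (ρ n = s ∧ ρ (n + 1) = t) → recurrentEdge ρ s t := by
    intro s t
    by_cases hst : recurrentEdge ρ s t
    · exact .of_forall fun _ _ => hst
    · filter_upwards [not_frequently.1 hst] with n hn h
      exact absurd h hn
  have h2 : ∀ᶠ n in atTop, ∀ s t, (ρ n = s ∧ ρ (n + 1) = t) → recurrentEdge ρ s t := by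
    simp only [eventually_all]
    exact h
  filter_upwards [h2] with n hn
  exact hn _ _ ⟨rfl, rfl⟩

lemma recurrentEdge_connected (ρ : ℕ → V) {s s' t t' : V} (hs : recurrentEdge ρ s s')
    (ht : recurrentEdge ρ t t') : Relation.ReflTransGen (recurrentEdge ρ) s t := by
  obtain ⟨N, hN⟩ := eventually_atTop.1 (eventually_recurrentEdge ρ)
  obtain ⟨n, hn, hns, -⟩ := frequently_atTop.1 hs N
  obtain ⟨m, hm, hmt, -⟩ := frequently_atTop.1 ht n
  have h : ∀ m ≥ n, Relation.ReflTransGen (recurrentEdge ρ) (ρ n) (ρ m) := by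
    intro m hm
    induction m, hm using Nat.le_induction with
    | base => exact .refl
    | succ m hm ih => exact ih.tail (hN m (hn.trans hm))
  rw [← hns, ← hmt]
  exact h m hm

/-- Whether a run satisfies the parity objective depends only on the states that it visits
infinitely often. -/
lemma mem_parityObj_of_frequently_iff {M : MDP V} {parity : V → ℕ} {ρ ρ' : ℕ → V}
    (hρ : ρ ∈ M.parityObj parity) (hρ' : ρ' ∈ M.runs)
    (h : ∀ s, (∃ᶠ n in atTop, ρ' n = s) ↔ ∃ᶠ n in atTop, ρ n = s) : ρ' ∈ M.parityObj parity := by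
  have key : ∀ (ρ : ℕ → V) (c : ℕ), (∃ᶠ n in atTop, parity (ρ n) = c) ↔
      ∃ s, parity s = c ∧ ∃ᶠ n in atTop, ρ n = s := by
    intro ρ c
    have h1 : ∀ n, parity (ρ n) = c ↔ ∃ s, parity s = c ∧ ρ n = s := fun n => by simp
    simp only [h1, frequently_exists_iff, frequently_and_distrib_left]
  refine ⟨hρ', ?_⟩
  have := hρ.2
  simp only [key, ← h] at this
  simpa only [key] using this

lemma mem_parityObj_of_visits {M : MDP V} {parity : V → ℕ} {ρ₀ : ℕ → V}
    (hρ₀ : ρ₀ ∈ M.parityObj parity) {ρ : ℕ → V} (hρ : ρ ∈ M.runs)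
    (h : ∀ s, (∃ᶠ n in atTop, ρ n = s) ↔ ∃ t, recurrentEdge ρ₀ s t) : ρ ∈ M.parityObj parity :=
  mem_parityObj_of_frequently_iff hρ₀ hρ fun s => (h s).trans (frequently_eq_iff ρ₀ s).symm

end Recurrence

lemma mem_posMP_of_le {V : Type*} {M : MDP V} {cost : V → V → ℤ} {ρ : ℕ → V}
    (hρ : ρ ∈ M.runs) {η B : ℝ} (hη : 0 < η)
    (h : ∀ n : ℕ, η * n - B ≤ totalCost cost ρ n) : ρ ∈ M.posMP cost := by
  refine ⟨hρ, ?_⟩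
  have h1 : ((η / 2 : ℝ) : EReal) ≤
      liminf (fun n : ℕ => (((1 / (n : ℝ)) * (totalCost cost ρ n : ℝ) : ℝ) : EReal)) atTop := by
    refine le_liminf_of_le (by isBoundedDefault) ?_
    filter_upwards [eventually_gt_atTop 0, eventually_ge_atTop ⌈2 * B / η⌉₊] with n hn0 hn
    have h2 : 2 * B / η ≤ n := Nat.ceil_le.1 hn
    have h3 : (0 : ℝ) < n := by exact_mod_cast hn0
    rw [div_le_iff₀ hη] at h2
    rw [EReal.coe_le_coe_iff, one_div, ← div_eq_inv_mul, le_div_iff₀ h3]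
    linarith [h n]
  exact lt_of_lt_of_le (by exact_mod_cast half_pos hη) h1

lemma next_of_not_controlled {V : Type*} {M : MDP V} {s : V} (hs : s ∉ M.controlled)
    (σ : M.Strategy) (w : List V) : M.next σ w s = M.prob s hs := dif_neg hs

/-- The stationary randomised strategy that moves from `s` according to `q s`. -/
def Strategy.stationary {V : Type*} {M : MDP V} (q : V → PMF V)
    (hq : ∀ s ∈ M.controlled, ∀ t, q s t ≠ 0 → M.Edge s t) : M.Strategy where
  move _ s _ := q s
  edge_of_move _ s hs t h := hq s hs t h

/-- If `F` is positive somewhere on `S`, then some distribution with support `S` gives `F`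
a nonnegative mean. -/
lemma exists_pmf_support_eq {V : Type*} [Fintype V] (S : V → Prop) (F : V → ℝ) {t₀ : V}
    (h₀ : S t₀) (hF : 0 < F t₀) :
    ∃ q : PMF V, (∀ t, q t ≠ 0 ↔ S t) ∧ 0 ≤ ∑ t, (q t).toReal * F t := by
  classical
  obtain ⟨N, hN⟩ := exists_nat_gt ((∑ t, |F t|) / F t₀)
  have hN0 : N ≠ 0 := by
    rintro rfl
    have : 0 ≤ (∑ t, |F t|) / F t₀ := by positivity
    simp only [Nat.cast_zero] at hN
    linarith
  rw [div_lt_iff₀ hF] at hN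
  -- all weights are `1` on `S`, except for a large one at `t₀`
  let w : V → ENNReal := fun t => if t = t₀ then N else if S t then 1 else 0
  have hw : ∀ t, w t ≠ 0 ↔ S t := by
    intro t
    by_cases ht : t = t₀
    · subst ht; simp [w, h₀, hN0]
    · by_cases hS : S t <;> simp [w, ht, hS]
  have hw0 : tsum w ≠ 0 := fun h => (hw t₀).2 h₀ (ENNReal.tsum_eq_zero.1 h t₀)
  have hwlt : ∀ t, w t < ⊤ := by
    intro t
    simp only [w]
    split_ifs <;> simp
  have hwtop : tsum w ≠ ⊤ := by
    rw [tsum_fintype]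
    exact (ENNReal.sum_lt_top.2 fun t _ => hwlt t).ne
  refine ⟨PMF.normalize w hw0 hwtop, fun t => ?_, ?_⟩
  · rw [← hw, ← PMF.mem_support_iff, PMF.mem_support_normalize_iff]
  · have hnorm : ∀ t, (PMF.normalize w hw0 hwtop t).toReal * F t =
        (w t).toReal * F t * ((tsum w)⁻¹).toReal := by
      intro t
      rw [PMF.normalize_apply, ENNReal.toReal_mul, mul_right_comm]
    simp only [hnorm, ← Finset.sum_mul]
    refine mul_nonneg ?_ ENNReal.toReal_nonneg
    have h1 : ∀ t, (if t = t₀ then N * F t₀ else 0) - |F t| ≤ (w t).toReal * F t := by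
      intro t
      by_cases ht : t = t₀
      · subst ht; simp [w]
      · by_cases hS : S t
        · simp [w, ht, hS, neg_abs_le]
        · simp [w, ht, hS]
    refine le_trans ?_ (sum_le_sum fun t _ => h1 t)
    simp only [sum_sub_distrib, sum_ite_eq', mem_univ, if_true]
    linarith

section EndComponent

variable {V : Type*} [Fintype V] {M : MDP V} {U : V → V → Prop}

/-- A stationary strategy that uses exactly the edges of an end component, and gives `F` a
nonnegative mean at the controlled states if `F` is positive on some edge from each of them. -/
lemma exists_stationary (hU : M.IsEndComponent U) (F : V → V → ℝ)
    (hF : ∀ s ∈ M.controlled, (∃ t, U s t) → ∃ t, U s t ∧ 0 < F s t) :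
    ∃ σ : M.Strategy, ∃ q : V → PMF V, (∀ w s, M.next σ w s = q s) ∧
      (∀ s, (∃ t, U s t) → ∀ t, q s t ≠ 0 ↔ U s t) ∧
      ∀ s ∈ M.controlled, (∃ t, U s t) → 0 ≤ ∑ t, (q s t).toReal * F s t := by
  have h : ∀ s, ∃ q : PMF V, (∀ t, q t ≠ 0 → M.Edge s t) ∧
      (∀ hs : s ∉ M.controlled, q = M.prob s hs) ∧
      ((∃ t, U s t) → (∀ t, q t ≠ 0 ↔ U s t) ∧
        (s ∈ M.controlled → 0 ≤ ∑ t, (q t).toReal * F s t)) := by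
    intro s
    by_cases hs : s ∈ M.controlled
    · by_cases hUs : ∃ t, U s t
      · obtain ⟨t₀, h₀, hF₀⟩ := hF s hs hUs
        obtain ⟨q, hq, hq'⟩ := exists_pmf_support_eq (U s) (F s) h₀ hF₀
        exact ⟨q, fun t ht => hU.edge s t ((hq t).1 ht), fun h => absurd hs h,
          fun _ => ⟨hq, fun _ => hq'⟩⟩
      · obtain ⟨t, ht⟩ := M.sinkless s
        refine ⟨PMF.pure t, fun r hr => ?_, fun h => absurd hs h, fun h => absurd h hUs⟩
        rw [← PMF.mem_support_iff, PMF.mem_support_pure_iff] at hr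
        exact hr ▸ ht
    · exact ⟨M.prob s hs, M.edge_of_prob s hs, fun _ => rfl,
        fun h => ⟨fun t => (hU.iff_prob s hs h t).symm, fun h => absurd h hs⟩⟩
  choose q hq1 hq2 hq3 using h
  refine ⟨.stationary q fun s _ => hq1 s, q, fun w s => ?_, fun s hs => (hq3 s hs).1,
    fun s hs hUs => (hq3 s hUs).2 hs⟩
  by_cases hs : s ∈ M.controlled
  · exact dif_pos hs
  · rw [next_of_not_controlled hs, hq2 s hs]

variable [MeasurableSpace V] [DiscreteMeasurableSpace V]

/-- Almost surely, the edges taken infinitely often form an end component. -/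
lemma ae_isEndComponent_recurrentEdge (σ : M.Strategy) (p : V) :
    ∀ᵐ ρ ∂M.runMeasure σ p, M.IsEndComponent (recurrentEdge ρ) := by
  have h : ∀ᵐ ρ ∂M.runMeasure σ p, ∀ s (hs : s ∉ M.controlled) t, M.prob s hs t ≠ 0 →
      (∃ᶠ n in atTop, ρ n = s) → recurrentEdge ρ s t := by
    simp only [ae_all_iff, eventually_imp_distrib_left]
    intro s hs t ht
    refine ae_frequently_edge (c := (M.prob s hs t).toReal)
      (ENNReal.toReal_pos ht (PMF.apply_ne_top _ _)) fun w => ?_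
    rw [next_of_not_controlled hs]
  filter_upwards [h, ae_next_ne_zero (M := M) (σ := σ) (p := p)] with ρ h1 h2
  refine ⟨fun s t hst => ?_, fun s t hst => ?_, fun s s' t t' => recurrentEdge_connected ρ,
    fun s hs hex t => ⟨fun hst => ?_, fun ht => ?_⟩⟩
  · obtain ⟨n, rfl, rfl⟩ := hst.exists
    exact edge_of_next (h2 n)
  · exact (frequently_eq_iff ρ t).1
      (frequently_succ_iff.1 (hst.mono fun n hn => hn.2))
  · obtain ⟨n, rfl, rfl⟩ := hst.exists
    rw [← next_of_not_controlled hs σ]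
    exact h2 n
  · exact h1 s hs t ht ((frequently_eq_iff ρ s).2 hex)

/-- A stationary strategy that uses exactly the edges of an end component almost surely stays in it
and visits precisely its states infinitely often. -/
lemma ae_visits_endComponent (hU : M.IsEndComponent U) {σ : M.Strategy} {q : V → PMF V}
    (hσ : ∀ w s, M.next σ w s = q s) (hq : ∀ s, (∃ t, U s t) → ∀ t, q s t ≠ 0 ↔ U s t) {p : V}
    (hp : ∃ t, U p t) :
    ∀ᵐ ρ ∂M.runMeasure σ p, (∀ n, U (ρ n) (ρ (n + 1))) ∧
      ∀ s, (∃ᶠ n in atTop, ρ n = s) ↔ ∃ t, U s t := by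
  have h : ∀ᵐ ρ ∂M.runMeasure σ p, ∀ s t, U s t → (∃ᶠ n in atTop, ρ n = s) →
      ∃ᶠ n in atTop, ρ n = s ∧ ρ (n + 1) = t := by
    simp only [ae_all_iff, eventually_imp_distrib_left]
    intro s t hst
    refine ae_frequently_edge (c := (q s t).toReal)
      (ENNReal.toReal_pos ((hq s ⟨t, hst⟩ t).2 hst) (PMF.apply_ne_top _ _)) fun w => ?_
    rw [hσ]
  filter_upwards [h, ae_next_ne_zero (M := M) (σ := σ) (p := p),
    ae_zero_eq (M := M) (σ := σ) (p := p)] with ρ h1 h2 h3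
  have hstay : ∀ n, U (ρ n) (ρ (n + 1)) := by
    have step : ∀ n, (∃ t, U (ρ n) t) → U (ρ n) (ρ (n + 1)) := by
      intro n hn
      have := h2 n
      rw [hσ] at this
      exact (hq _ hn _).1 this
    intro n
    induction n with
    | zero => exact step 0 (h3 ▸ hp)
    | succ n ih => exact step _ (hU.exists_succ _ _ ih)
  refine ⟨hstay, fun s => ⟨fun hs => ?_, fun ⟨t, hst⟩ => ?_⟩⟩
  · obtain ⟨n, rfl⟩ := hs.exists
    exact ⟨_, hstay n⟩
  · obtain ⟨r, hr⟩ := (frequently_exists_iff (P := fun v n => ρ n = v)).1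
      (Frequently.of_forall fun n => ⟨ρ n, rfl⟩)
    have hrU : ∃ t, U r t := by
      obtain ⟨n, rfl⟩ := hr.exists
      exact ⟨_, hstay n⟩
    have hpath : ∀ s, Relation.ReflTransGen U r s → ∃ᶠ n in atTop, ρ n = s := by
      intro s hs
      induction hs with
      | refl => exact hr
      | tail _ hbc ih => exact frequently_succ_iff.1 ((h1 _ _ hbc ih).mono fun n hn => hn.2)
    exact hpath s (hU.connected r _ s _ hrU.choose_spec hst)

variable {cost : V → V → ℤ} {parity : V → ℕ} {ρ₀ : ℕ → V}

lemma runMeasure_eq_one {σ : M.Strategy} {p : V} {O : Set (ℕ → V)}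
    (h : ∀ᵐ ρ ∂M.runMeasure σ p, ρ ∈ O) : M.runMeasure σ p O = 1 := by
  rw [← measure_univ (μ := M.runMeasure σ p)]
  exact measure_congr (eventuallyEq_univ.2 h)

/-- If the costs on an end component are the differences of a potential, then the energy level
is bounded there. -/
lemma mem_setA_of_tight (hU : M.IsEndComponent (recurrentEdge ρ₀))
    (hρ₀ : ρ₀ ∈ M.parityObj parity) {h : V → ℝ}
    (hh : ∀ s t, recurrentEdge ρ₀ s t → h s = cost s t + h t) {p : V}
    (hp : ∃ t, recurrentEdge ρ₀ p t) : p ∈ M.setA cost parity := by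
  obtain ⟨σ, q, hσ, hq, -⟩ := exists_stationary hU (fun _ _ => 1)
    fun s _ ⟨t, ht⟩ => ⟨t, ht, one_pos⟩
  obtain ⟨K, -, hK⟩ := exists_abs_le fun s _ : V => h s
  refine ⟨⌈2 * K⌉₊, σ, runMeasure_eq_one ?_⟩
  filter_upwards [ae_visits_endComponent hU hσ hq hp] with ρ hρ
  have hruns : ρ ∈ M.runs := fun n => hU.edge _ _ (hρ.1 n)
  refine ⟨⟨hruns, fun n => ?_⟩, mem_parityObj_of_visits hρ₀ hruns hρ.2⟩
  have h1 : ((totalCost cost ρ n : ℤ) : ℝ) = h (ρ 0) - h (ρ n) := by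
    unfold totalCost
    rw [← sum_range_sub' (fun i => h (ρ i)), Int.cast_sum]
    exact sum_congr rfl fun i _ => by linarith [hh _ _ (hρ.1 i)]
  have h2 := Nat.le_ceil (2 * K)
  have h3 := abs_le.1 (hK (ρ 0) p)
  have h4 := abs_le.1 (hK (ρ n) p)
  have h5 : (0 : ℝ) ≤ ((⌈2 * K⌉₊ : ℤ) + totalCost cost ρ n : ℤ) := by
    push_cast
    linarith
  exact_mod_cast h5

/-- If the Bellman operator strictly increases some function on an end component, then there is
a strategy of positive mean payoff that visits all its states. -/
lemma mem_setB_of_subharmonic (hU : M.IsEndComponent (recurrentEdge ρ₀))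
    (hρ₀ : ρ₀ ∈ M.parityObj parity) {h : V → ℝ} {η : ℝ} (hη : 0 < η)
    (hh : ∀ s, (∃ t, recurrentEdge ρ₀ s t) → h s + η ≤ bellman M cost (recurrentEdge ρ₀) h s)
    {p : V} (hp : ∃ t, recurrentEdge ρ₀ p t) : p ∈ M.setB cost parity := by
  classical
  obtain ⟨σ, q, hσ, hq, hqF⟩ := exists_stationary hU
    -- half of `η` is given up so that all edges can get positive probability
    (fun s t => cost s t + h t - h s - η / 2) (by
      rintro s hs ⟨t, hst⟩
      have h1 := hh s ⟨t, hst⟩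
      rw [bellman_of_controlled hs hst] at h1
      have : Nonempty {t // recurrentEdge ρ₀ s t} := ⟨⟨t, hst⟩⟩
      obtain ⟨⟨r, hr⟩, hr'⟩ := exists_eq_ciSup_of_finite
        (f := fun t : {t // recurrentEdge ρ₀ s t} => (cost s t + h t : ℝ))
      refine ⟨r, hr, ?_⟩
      rw [← hr'] at h1
      dsimp only at h1
      linarith)
  -- the value off the end component, which is never left, is chosen so that the mean bound holds
  let g : V → V → ℝ := fun s t =>
    if ∃ r, recurrentEdge ρ₀ s r then cost s t + h t - h s else η / 2
  have hg : ∀ w s, η / 2 ≤ ∑ t, (M.next σ w s t).toReal * g s t := by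
    intro w s
    by_cases hs : ∃ r, recurrentEdge ρ₀ s r
    · simp only [g, if_pos hs]
      by_cases hc : s ∈ M.controlled
      · have h1 := hqF s hc hs
        rw [hσ]
        simp only [mul_sub, mul_add, sum_sub_distrib, sum_add_distrib, ← Finset.sum_mul,
          sum_toReal_pmf, one_mul] at h1 ⊢
        linarith
      · have h1 := hh s hs
        rw [bellman_of_not_controlled hc hs.choose_spec] at h1
        rw [next_of_not_controlled hc]
        simp only [mul_sub, mul_add, sum_sub_distrib, sum_add_distrib, ← Finset.sum_mul,
          sum_toReal_pmf, one_mul] at h1 ⊢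
        linarith
    · simp only [g, if_neg hs, ← Finset.sum_mul, sum_toReal_pmf, one_mul, le_refl]
  obtain ⟨K, -, hK⟩ := exists_abs_le fun s _ : V => h s
  refine ⟨σ, runMeasure_eq_one ?_⟩
  filter_upwards [ae_visits_endComponent hU hσ hq hp, ae_linear_growth (half_pos hη) hg]
    with ρ hρ ⟨B, hB⟩
  have hruns : ρ ∈ M.runs := fun n => hU.edge _ _ (hρ.1 n)
  refine ⟨mem_posMP_of_le (η := η / 2 / 2) (B := B + 2 * K) hruns (by positivity) fun n => ?_,
    mem_parityObj_of_visits hρ₀ hruns hρ.2⟩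
  have h1 : ∑ i ∈ range n, g (ρ i) (ρ (i + 1)) = totalCost cost ρ n + (h (ρ n) - h (ρ 0)) := by
    unfold totalCost
    rw [← sum_range_sub (fun i => h (ρ i)), Int.cast_sum, ← sum_add_distrib]
    refine sum_congr rfl fun i _ => ?_
    simp only [g, if_pos (⟨_, hρ.1 i⟩ : ∃ r, recurrentEdge ρ₀ (ρ i) r)]
    ring
  have h2 := hB n
  rw [h1] at h2
  have h3 := abs_le.1 (hK (ρ 0) p)
  have h4 := abs_le.1 (hK (ρ n) p)
  linarith

/-- The total cost corrected by a superharmonic potential is a supermartingale, so on the runs where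
it is bounded below, the edges taken infinitely often preserve it. -/
lemma ae_tight_of_superharmonic (hU : M.IsEndComponent U) {h : V → ℝ}
    (hh : ∀ s, (∃ t, U s t) → bellman M cost U h s ≤ h s) (σ : M.Strategy) (p : V) (k : ℕ) :
    ∀ᵐ ρ ∂M.runMeasure σ p, recurrentEdge ρ = U → ρ ∈ M.energy cost k →
      ∀ s t, U s t → h s = cost s t + h t := by
  classical
  let g : V → V → ℝ := fun s t => if U s t then h s - (cost s t + h t) else 0
  have hg : ∀ w s, 0 ≤ ∑ t, (M.next σ w s t).toReal * g s t := by
    intro w s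
    by_cases hc : s ∈ M.controlled
    · refine sum_nonneg fun t _ => mul_nonneg ENNReal.toReal_nonneg ?_
      simp only [g]
      split_ifs with hst
      · linarith [hh s ⟨t, hst⟩, le_bellman_of_controlled (cost := cost) hc hst h]
      · exact le_rfl
    · by_cases hs : ∃ t, U s t
      · have h1 := hh s hs
        rw [bellman_of_not_controlled hc hs.choose_spec] at h1
        have h2 : ∑ t, (M.next σ w s t).toReal * g s t =
            ∑ t, (M.prob s hc t).toReal * (h s - (cost s t + h t)) := by
          rw [next_of_not_controlled hc]
          refine sum_congr rfl fun t _ => ?_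
          by_cases ht : U s t
          · simp only [g, if_pos ht]
          · have : M.prob s hc t = 0 := by
              by_contra h0
              exact ht ((hU.iff_prob s hc hs t).2 h0)
            simp [this]
        rw [h2]
        simp only [mul_sub, sum_sub_distrib, ← Finset.sum_mul, sum_toReal_pmf, one_mul]
        linarith
      · refine sum_nonneg fun t _ => ?_
        simp only [g, if_neg fun ht => hs ⟨t, ht⟩, mul_zero, le_refl]
  filter_upwards [ae_eventually_eq_zero hg] with ρ hρ hrec hen s t hst
  obtain ⟨K, -, hK⟩ := exists_abs_le fun s _ : V => h s
  obtain ⟨N, hN⟩ := eventually_atTop.1 (eventually_recurrentEdge ρ)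
  rw [hrec] at hN
  -- from time `N` on, the increments telescope against the total cost
  have hconst : ∀ n ≥ N, ∑ i ∈ range n, g (ρ i) (ρ (i + 1)) + totalCost cost ρ n + h (ρ n) =
      ∑ i ∈ range N, g (ρ i) (ρ (i + 1)) + totalCost cost ρ N + h (ρ N) := by
    intro n hn
    induction n, hn using Nat.le_induction with
    | base => rfl
    | succ n hn ih =>
      rw [← ih, sum_range_succ, totalCost, totalCost, sum_range_succ]
      simp only [g, if_pos (hN n hn)]
      push_cast
      ring
  have hbdd : BddAbove (Set.range fun n => ∑ i ∈ range n, g (ρ i) (ρ (i + 1))) := by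
    refine (isBoundedUnder_of_eventually_le (a := ∑ i ∈ range N, g (ρ i) (ρ (i + 1)) +
      totalCost cost ρ N + h (ρ N) + k + K) ?_).bddAbove_range
    filter_upwards [eventually_ge_atTop N] with n hn
    have h1 : (0 : ℝ) ≤ ((k : ℤ) + totalCost cost ρ n : ℤ) := by exact_mod_cast hen.2 n
    push_cast at h1
    linarith [hconst n hn, abs_le.1 (hK (ρ n) p)]
  obtain ⟨n, hn, hn0⟩ := ((hrec ▸ hst : recurrentEdge ρ s t).and_eventually (hρ hbdd)).exists
  rw [hn.1, hn.2] at hn0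
  simp only [g, if_pos hst] at hn0
  linarith

/-- Almost every run that satisfies an energy-parity objective visits `A ∪ B`. -/
lemma ae_mem_reach (σ : M.Strategy) (p : V) (k : ℕ) :
    ∀ᵐ ρ ∂M.runMeasure σ p, ρ ∈ M.energy cost k ∩ M.parityObj parity →
      ρ ∈ M.reach (M.setA cost parity ∪ M.setB cost parity) := by
  have key : ∀ᵐ ρ ∂M.runMeasure σ p, ∀ U : V → V → Prop, M.IsEndComponent U →
      recurrentEdge ρ = U → ρ ∈ M.energy cost k ∩ M.parityObj parity →
      ∀ s, (∃ t, U s t) → s ∈ M.setA cost parity ∪ M.setB cost parity := by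
    simp only [ae_all_iff, eventually_imp_distrib_left]
    intro U hU
    rcases bellman_dichotomy hU cost with ⟨h, hh⟩ | ⟨h, η, hη, hh⟩
    · filter_upwards [ae_tight_of_superharmonic hU hh σ p k] with ρ hρ hrec hmem s hs
      have htight := hρ hrec hmem.1
      subst hrec
      exact Or.inl (mem_setA_of_tight hU hmem.2 htight hs)
    · refine .of_forall fun ρ hrec hmem s hs => ?_
      subst hrec
      exact Or.inr (mem_setB_of_subharmonic hU hmem.2 hη hh hs)
  filter_upwards [key, ae_isEndComponent_recurrentEdge σ p] with ρ h1 h2 hmem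
  obtain ⟨n, hn⟩ := (eventually_recurrentEdge ρ).exists
  exact ⟨hmem.1.1, n, h1 _ h2 rfl hmem _ ⟨_, hn⟩⟩

end EndComponent

end MDP

theorem theorem6 {V : Type*} [Finite V] [MeasurableSpace V] [DiscreteMeasurableSpace V]
    (M : MDP V) (cost : V → V → ℤ) (parity : V → ℕ) (p : V) :
    M.limitValue cost parity p =
      ⨆ σ : M.Strategy, M.runMeasure σ p (M.reach (M.setA cost parity ∪ M.setB cost parity)) := by
  cases nonempty_fintype V
  refine le_antisymm (iSup_le fun k => iSup_le fun σ => ?_)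
    (iSup_le fun σ => MDP.runMeasure_reach_le_limitValue σ p)
  exact le_iSup_of_le σ (measure_mono_ae (MDP.ae_mem_reach σ p k))
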